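/- Let $m\ge 1$ be an integer, $\lambda>0$, and let $\{X(i)\}_{i\ge0}$ be i.i.d. with the Gamma density $f(x)=\frac{\lambda^m}{\Gamma(m)}x^{m-1}e^{-\lambda x}$, $x>0$, whose mean is $\bar X=m/\lambda$. Let $M>\bar X$ and put $\delta=M/\bar X=\lambda M/m$. Consider the energy stored in a buffer of infinite size under the best-effort policy, i.e. the Markov chain on $[0,\infty)$ $$B(i+1)=\max(B(i)-M,0)+X(i),\qquad i\ge 0,$$ where the initial energy $B(0)\ge 0$ is independent of $\{X(i)\}$ and otherwise arbitrary. Let $W_0$ be the principal branch of the Lambert W function (the inverse of $w\mapsto we^w$), and for $n=0,\dots,m-1$ let $$\lambda_n=\lambda+\frac mM\,W_0\!\left(-\delta e^{-\delta}e^{-2\pi \mathrm j n/m}\right),\qquad \mathrm j=\sqrt{-1}.$$ Let $A$ be the complex $m\times m$ matrix with entries $A_{s,n}=\left(\frac{\lambda-\lambda_n}{\lambda}\right)^s$, $s,n\in\{0,\dots,m-1\}$. Then $A$ is invertible, and if $c=(c_0,\dots,c_{m-1})^T$ is the solution of $Ac=\mathbf 1_m$ (all ones), then the chain has a limiting distribution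 $\pi$ on $(0,\infty)$, that is, $\pi$ is a stationary probability distribution and, from every initial distribution, the law of $B(i)$ converges to $\pi$ in total variation as $i\to\infty$. Its cdf is $$G(x)=1-\sum_{n=0}^{m-1}c_n e^{-\lambda_n x},\qquad x\ge 0,$$ and it is absolutely continuous with pdf $$g(x)=\sum_{n=0}^{m-1}\lambda_n c_n e^{-\lambda_n x},\qquad x>0;$$ in particular these sums are real, and the second one is nonnegative. -/

import Mathlib

open MeasureTheory ProbabilityTheory Filter Set
open scoped Matrix

universe u

/-- The range of the principal branch of the Lambert W function: the region
`{ξ + iη : -π < η < π, ξ > -η cot η}` (read as `ξ > -1` at `η = 0`), together with the part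
`0 ≤ η` of its boundary curve, which is the image of the branch cut `(-∞, -1/e]`. -/
def lambertRange : Set ℂ :=
  {w | (w.im = 0 ∧ -1 ≤ w.re) ∨
    (0 < w.im ∧ w.im < Real.pi ∧ -w.im * (Real.cos w.im / Real.sin w.im) ≤ w.re) ∨
    (-Real.pi < w.im ∧ w.im < 0 ∧ -w.im * (Real.cos w.im / Real.sin w.im) < w.re)}

/-- The principal branch `W₀` of the Lambert W function: the inverse of `w ↦ w * exp w`
restricted to the principal range, on which this map is a bijection onto `ℂ`. -/
noncomputable def lambertW0 (z : ℂ) : ℂ :=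
  Function.invFunOn (fun w : ℂ => w * Complex.exp w) lambertRange z

/-- `B` is the energy stored in a buffer of infinite capacity under the best-effort policy, which
spends `min (B i) M` in slot `i`, when the harvested energies `X 0, X 1, …` are i.i.d. with law `ξ`
and independent of the (arbitrary, nonnegative) initial energy `B 0`. -/
structure IsBestEffortStorage {Ω : Type*} [MeasurableSpace Ω] (M : ℝ) (ξ : Measure ℝ)
    (P : Measure Ω) (X B : ℕ → Ω → ℝ) : Prop where
  measurable_harvest : ∀ i, Measurable (X i)
  measurable_stored : ∀ i, Measurable (B i)
  law_harvest : ∀ i, P.map (X i) = ξ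
  indep_harvest : iIndepFun X P
  indep_init : IndepFun (B 0) (fun ω i => X i ω) P
  init_nonneg : ∀ᵐ ω ∂P, 0 ≤ B 0 ω
  storage_eq : ∀ i, ∀ᵐ ω ∂P, B (i + 1) ω = max (B i ω - M) 0 + X i ω

/-- Convergence in total variation of a sequence of laws on `ℝ`: convergence of the probabilities
of all measurable sets, uniformly over these sets. -/
def TendstoInTotalVariation (ν : ℕ → Measure ℝ) (π : Measure ℝ) : Prop :=
  ∀ ε : ℝ, 0 < ε → ∀ᶠ i in atTop, ∀ s : Set ℝ, MeasurableSet s →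
    |(ν i).real s - π.real s| ≤ ε

/-- `π` is the limiting distribution of the energy stored under the best-effort policy: it is a
stationary distribution, and from every initial distribution the law of the stored energy converges
to `π` in total variation. -/
def IsLimitingDistribution (M : ℝ) (ξ π : Measure ℝ) : Prop :=
  ∀ (Ω : Type u) [MeasurableSpace Ω] (P : Measure Ω) [IsProbabilityMeasure P]
    (X B : ℕ → Ω → ℝ), IsBestEffortStorage M ξ P X B →
    (P.map (B 0) = π → ∀ i, P.map (B i) = π) ∧
      TendstoInTotalVariation (fun i => P.map (B i)) π

/-- The exponents `λₙ = λ + (m/M) W₀(-δ e^{-δ} e^{-2πjn/m})`. -/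
noncomputable def rate (m : ℕ) (lam M δ : ℝ) (n : Fin m) : ℂ :=
  (lam : ℂ) + ((m : ℂ) / (M : ℂ)) *
    lambertW0 (-(δ : ℂ) * Complex.exp (-(δ : ℂ)) *
      Complex.exp (-(Complex.I * (2 * (Real.pi : ℂ) * (n : ℂ) / (m : ℂ)))))

/-- The matrix `A` with entries `A s n = ((λ - λₙ) / λ) ^ s`. -/
noncomputable def coeffMatrix (m : ℕ) (lam M δ : ℝ) : Matrix (Fin m) (Fin m) ℂ :=
  Matrix.of fun s n => (((lam : ℂ) - rate m lam M δ n) / (lam : ℂ)) ^ (s : ℕ)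

/-! ### The principal branch of the Lambert function on the disc `‖z‖ < e⁻¹` -/

/-! Write `r n` for the nodes (λ - λₙ)/λ, which equal -W₀(·)/δ. Since δ > 1, the Lambert arguments
have modulus δe^{-δ} < e⁻¹. There W₀ takes values in the open unit disc and solves w e^w = z. Hence
|r n| < 1/δ, the nodes are distinct, and (r n)^m = exp(-λₙ M) (`node_pow`); `A` is a transposed
Vandermonde matrix.

A stationary cdf must satisfy G(x) = ∫₀ˣ f(u) G(x - u + M) du. Applied to exp(-λₙ x), this operator
returns the same exponential minus ∑_{s<m} e^{-λx} (λx)^s/s! · (r n)^s; applied to 1, it returns 1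
minus the same sum without the powers of the node. The remainders cancel because `A c = 1` says ∑ cₙ
(r n)^s = 1 for s < m (`expSumCdf_eq_integral`).

Realness and monotonicity of G are not visible in the formula. They come from iterating the operator
on the constant 1: the iterates are real, nonnegative and nondecreasing on [0, ∞). With weight
e^{-θx}, θ = λ(1 - 1/δ) ≤ Re λₙ, each application contracts by (δe^{1-δ})^m < 1, so the iterates
converge to G (`norm_storageCdf_sub_le`). With G(0) = 0 and G(∞) = 1, the derivative of G is a
probability density, and the integral equation is invariance.

Convergence is a coupling argument. A stationary chain is run with the same harvests. As their mean
is below M, the strong law forces both chains to be at most M at a common time, after which they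
agree (`eventually_eq_of_storage`). -/

lemma mul_cos_le_sin {x : ℝ} (h0 : 0 ≤ x) (hpi : x ≤ Real.pi) : x * Real.cos x ≤ Real.sin x := by
  rcases lt_or_ge x (Real.pi / 2) with hx | hx
  · have hc : 0 < Real.cos x := Real.cos_pos_of_mem_Ioo ⟨by linarith [Real.pi_pos], hx⟩
    have := Real.le_tan h0 hx
    rwa [Real.tan_eq_sin_div_cos, le_div_iff₀ hc] at this
  · have hc : Real.cos x ≤ 0 :=
      Real.cos_nonpos_of_pi_div_two_le_of_le hx (by linarith [Real.pi_pos])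
    exact (mul_nonpos_of_nonneg_of_nonpos h0 hc).trans (Real.sin_nonneg_of_nonneg_of_le_pi h0 hpi)

lemma neg_one_le_neg_mul_cot {x : ℝ} (h0 : 0 < x) (hpi : x < Real.pi) :
    -1 ≤ -x * (Real.cos x / Real.sin x) := by
  have hs := Real.sin_pos_of_pos_of_lt_pi h0 hpi
  rw [← mul_div_assoc, le_div_iff₀ hs]
  linarith [mul_cos_le_sin h0.le hpi.le]

lemma neg_one_le_re_of_mem_lambertRange {w : ℂ} (hw : w ∈ lambertRange) : -1 ≤ w.re := by
  rcases hw with ⟨-, h⟩ | ⟨h0, hpi, h⟩ | ⟨hpi, h0, h⟩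
  · exact h
  · exact (neg_one_le_neg_mul_cot h0 hpi).trans h
  · have := neg_one_le_neg_mul_cot (x := -w.im) (by linarith) (by linarith)
    rw [Real.cos_neg, Real.sin_neg, div_neg] at this
    linarith

/-- This puts the open unit disc inside the principal range. If it failed, squaring x cos x ≤ -y sin
x and using y² < 1 - x² would give x² < sin² x. -/
lemma neg_mul_cot_lt {x y : ℝ} (hx : 0 < x) (h : y ^ 2 + x ^ 2 < 1) :
    -x * (Real.cos x / Real.sin x) < y := by
  have hx1 : x < 1 := by nlinarith [sq_nonneg y]
  have hs : 0 < Real.sin x := Real.sin_pos_of_pos_of_lt_pi hx (by linarith [Real.pi_gt_three])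
  have hc : 0 < Real.cos x :=
    Real.cos_pos_of_mem_Ioo ⟨by linarith [Real.pi_pos], by linarith [Real.pi_gt_three]⟩
  rw [← mul_div_assoc, div_lt_iff₀ hs]
  have hsx : Real.sin x < x := Real.sin_lt hx
  by_contra! hcon
  have h1 : 0 ≤ -y * Real.sin x - x * Real.cos x := by linarith
  have h2 : (x * Real.cos x) ^ 2 ≤ (-y * Real.sin x) ^ 2 :=
    pow_le_pow_left₀ (by positivity) (by linarith) 2
  have h3 : Real.sin x ^ 2 ≤ x ^ 2 := pow_le_pow_left₀ hs.le hsx.le 2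
  have h4 : y ^ 2 * Real.sin x ^ 2 < (1 - x ^ 2) * Real.sin x ^ 2 :=
    mul_lt_mul_of_pos_right (by linarith) (by positivity)
  have h5 := Real.sin_sq_add_cos_sq x
  have h6 : Real.cos x ^ 2 = 1 - Real.sin x ^ 2 := by linarith
  rw [mul_pow, h6] at h2
  nlinarith

lemma mem_lambertRange_of_norm_lt_one {w : ℂ} (hw : ‖w‖ < 1) : w ∈ lambertRange := by
  have hsq : w.re ^ 2 + w.im ^ 2 < 1 := by
    have h1 : ‖w‖ ^ 2 < 1 := by nlinarith [norm_nonneg w]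
    rw [← Complex.normSq_eq_norm_sq, Complex.normSq_apply] at h1
    nlinarith
  have him : |w.im| < 1 := (Complex.abs_im_le_norm w).trans_lt hw
  have hre : |w.re| < 1 := (Complex.abs_re_le_norm w).trans_lt hw
  rw [abs_lt] at him hre
  have hpi := Real.pi_gt_three
  rcases lt_trichotomy w.im 0 with h | h | h
  · refine Or.inr (Or.inr ⟨by linarith, h, ?_⟩)
    have := neg_mul_cot_lt (x := -w.im) (y := w.re) (by linarith) (by simpa using hsq)
    rw [Real.cos_neg, Real.sin_neg, div_neg] at this
    linarith
  · exact Or.inl ⟨h, by linarith⟩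
  · exact Or.inr (Or.inl ⟨h, by linarith, (neg_mul_cot_lt h hsq).le⟩)

/-- On the range Re w ≥ -1, so |w e^w| ≥ |w| e⁻¹. -/
lemma norm_lt_one_of_mem_lambertRange {w : ℂ} (hw : w ∈ lambertRange)
    (h : ‖w * Complex.exp w‖ < Real.exp (-1)) : ‖w‖ < 1 := by
  have hre := neg_one_le_re_of_mem_lambertRange hw
  rw [norm_mul, Complex.norm_exp] at h
  have h1 : ‖w‖ * Real.exp (-1) ≤ ‖w‖ * Real.exp w.re := by gcongr
  have h2 : ‖w‖ * Real.exp (-1) < 1 * Real.exp (-1) := by linarith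
  exact lt_of_mul_lt_mul_right h2 (Real.exp_pos _).le

/-- The map w ↦ z e^{-w} is a contraction of the closed unit disc with constant e|z| < 1; its fixed
point is the solution. -/
lemma exists_norm_lt_one_mul_exp_eq {z : ℂ} (hz : ‖z‖ < Real.exp (-1)) :
    ∃ w : ℂ, ‖w‖ < 1 ∧ w * Complex.exp w = z := by
  set K : NNReal := ⟨‖z‖ * Real.exp 1, by positivity⟩ with hK
  have hK1 : K < 1 := by
    rw [← NNReal.coe_lt_coe]
    change ‖z‖ * Real.exp 1 < 1
    calc ‖z‖ * Real.exp 1 < Real.exp (-1) * Real.exp 1 := by gcongr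
      _ = 1 := by rw [← Real.exp_add]; simp
  have hbound : ∀ w ∈ Metric.closedBall (0 : ℂ) 1, ‖z * Complex.exp (-w)‖ ≤ K := by
    intro w hw
    rw [mem_closedBall_zero_iff] at hw
    rw [norm_mul, Complex.norm_exp]
    have : (-w).re ≤ 1 := ((Complex.re_le_norm _).trans_eq (norm_neg w)).trans hw
    change _ ≤ ‖z‖ * Real.exp 1
    gcongr
  have hmaps : MapsTo (fun w => z * Complex.exp (-w)) (Metric.closedBall (0 : ℂ) 1)
      (Metric.closedBall 0 1) := fun w hw => by
    rw [mem_closedBall_zero_iff]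
    exact (hbound w hw).trans (by exact_mod_cast hK1.le)
  have hlip : LipschitzOnWith K (fun w => z * Complex.exp (-w)) (Metric.closedBall (0 : ℂ) 1) := by
    refine (convex_closedBall 0 1).lipschitzOnWith_of_nnnorm_hasDerivWithin_le
      (f' := fun w => z * (Complex.exp (-w) * (-1))) (fun w _ => ?_) fun w hw => ?_
    · exact (((hasDerivAt_neg w).cexp).const_mul z).hasDerivWithinAt
    · have := hbound w hw
      rw [← NNReal.coe_le_coe, coe_nnnorm]
      simpa using this
  have hcontr : ContractingWith K (hmaps.restrict _ _ _) :=
    ⟨hK1, fun x y => hlip x.2 y.2⟩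
  obtain ⟨w, hw, hfix, -⟩ := hcontr.exists_fixedPoint' Metric.isClosed_closedBall.isComplete hmaps
    (x := 0) (by simp) (edist_ne_top _ _)
  have hfix' : z * Complex.exp (-w) = w := hfix
  refine ⟨w, ?_, ?_⟩
  · calc ‖w‖ = ‖z * Complex.exp (-w)‖ := by rw [hfix']
      _ ≤ K := hbound w hw
      _ < 1 := by exact_mod_cast hK1
  · nth_rewrite 1 [← hfix']
    rw [mul_assoc, ← Complex.exp_add]
    simp

/-- Existence of a preimage in the range suffices: whichever one `invFunOn` chooses lies in the
disc, so injectivity on the range plays no role. -/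
lemma norm_lambertW0_lt_one_and_mul_exp {z : ℂ} (hz : ‖z‖ < Real.exp (-1)) :
    ‖lambertW0 z‖ < 1 ∧ lambertW0 z * Complex.exp (lambertW0 z) = z := by
  obtain ⟨w, hw, hwz⟩ := exists_norm_lt_one_mul_exp_eq hz
  have hex : ∃ a ∈ lambertRange, (fun w : ℂ => w * Complex.exp w) a = z :=
    ⟨w, mem_lambertRange_of_norm_lt_one hw, hwz⟩
  have heq : lambertW0 z * Complex.exp (lambertW0 z) = z := Function.invFunOn_eq hex
  refine ⟨norm_lt_one_of_mem_lambertRange (Function.invFunOn_mem hex) ?_, heq⟩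
  rwa [heq]

/-! ### The nodes of the coefficient matrix -/

/-- The node `(λ - λₙ) / λ` of the coefficient matrix. -/
noncomputable def node (m : ℕ) (lam M δ : ℝ) (n : Fin m) : ℂ :=
  ((lam : ℂ) - rate m lam M δ n) / (lam : ℂ)

lemma rate_eq_mul_one_sub_node {m : ℕ} {lam : ℝ} (hlam : lam ≠ 0) (M δ : ℝ) (n : Fin m) :
    rate m lam M δ n = lam * (1 - node m lam M δ n) := by
  have : (lam : ℂ) ≠ 0 := by exact_mod_cast hlam
  rw [node]
  field_simp
  ring

lemma mul_exp_neg_lt {δ : ℝ} (hδ : 1 < δ) : δ * Real.exp (-δ) < Real.exp (-1) := by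
  have h := Real.add_one_lt_exp (sub_ne_zero.2 hδ.ne')
  calc δ * Real.exp (-δ) < Real.exp (δ - 1) * Real.exp (-δ) := by
        gcongr; linarith
    _ = Real.exp (-1) := by rw [← Real.exp_add]; congr 1; ring

section Node

variable {m : ℕ} {lam M δ : ℝ}

lemma norm_lambertArg_lt (hδ : 1 < δ) (n : Fin m) :
    ‖-(δ : ℂ) * Complex.exp (-(δ : ℂ)) *
      Complex.exp (-(Complex.I * (2 * (Real.pi : ℂ) * (n : ℂ) / (m : ℂ))))‖ < Real.exp (-1) := by
  have h1 : ‖Complex.exp (-(Complex.I * (2 * (Real.pi : ℂ) * (n : ℂ) / (m : ℂ))))‖ = 1 := by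
    have := Complex.norm_exp_ofReal_mul_I (-(2 * Real.pi * (n : ℕ) / m))
    rw [← this]
    congr 2
    push_cast
    ring
  rw [norm_mul, h1, mul_one, norm_mul, norm_neg, Complex.norm_exp, Complex.norm_real,
    Real.norm_of_nonneg (by linarith)]
  simpa using mul_exp_neg_lt hδ

lemma node_eq (hlam : 0 < lam) (hδ : 0 < δ) (hm : 0 < m) (hM : lam * M = m * δ) (n : Fin m) :
    node m lam M δ n = -(lambertW0 (-(δ : ℂ) * Complex.exp (-(δ : ℂ)) *
      Complex.exp (-(Complex.I * (2 * (Real.pi : ℂ) * (n : ℂ) / (m : ℂ)))))) / δ := by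
  have hm' : (m : ℂ) ≠ 0 := by exact_mod_cast hm.ne'
  have hδ' : (δ : ℂ) ≠ 0 := by exact_mod_cast hδ.ne'
  have hlam' : (lam : ℂ) ≠ 0 := by exact_mod_cast hlam.ne'
  have hM' : (M : ℂ) = m * δ / lam := by
    rw [eq_div_iff hlam', mul_comm]
    exact_mod_cast hM
  rw [node, rate, hM']
  field_simp
  ring

lemma norm_node_lt (hlam : 0 < lam) (hδ : 1 < δ) (hm : 0 < m) (hM : lam * M = m * δ) (n : Fin m) :
    ‖node m lam M δ n‖ < 1 / δ := by
  have hδ0 : 0 < δ := by linarith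
  rw [node_eq hlam hδ0 hm hM, norm_div, norm_neg, Complex.norm_real, Real.norm_of_nonneg hδ0.le]
  gcongr
  exact (norm_lambertW0_lt_one_and_mul_exp (norm_lambertArg_lt hδ n)).1

lemma node_mul_exp (hlam : 0 < lam) (hδ : 1 < δ) (hm : 0 < m) (hM : lam * M = m * δ)
    (n : Fin m) :
    node m lam M δ n * Complex.exp (-(δ * node m lam M δ n)) = Complex.exp (-(δ : ℂ)) *
      Complex.exp (-(Complex.I * (2 * (Real.pi : ℂ) * (n : ℂ) / (m : ℂ)))) := by
  have hδ0 : 0 < δ := by linarith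
  have hδ' : (δ : ℂ) ≠ 0 := by exact_mod_cast hδ0.ne'
  have h := (norm_lambertW0_lt_one_and_mul_exp (norm_lambertArg_lt hδ n)).2
  rw [node_eq hlam hδ0 hm hM]
  set w := lambertW0 (-(δ : ℂ) * Complex.exp (-(δ : ℂ)) *
      Complex.exp (-(Complex.I * (2 * (Real.pi : ℂ) * (n : ℂ) / (m : ℂ)))))
  have hw : -((δ : ℂ) * (-w / δ)) = w := by field_simp
  rw [hw, div_mul_eq_mul_div, div_eq_iff hδ']
  linear_combination -h

/-- The m-th power of `node_mul_exp` removes the root of unity. The result is the characteristic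
equation that absorbs the shift by M in the integral equation. -/
lemma node_pow (hlam : 0 < lam) (hδ : 1 < δ) (hm : 0 < m) (hM : lam * M = m * δ)
    (n : Fin m) :
    node m lam M δ n ^ m = Complex.exp (-(rate m lam M δ n * M)) := by
  have hm' : (m : ℂ) ≠ 0 := by exact_mod_cast hm.ne'
  have hM' : (lam : ℂ) * M = m * δ := by exact_mod_cast hM
  have h := congrArg (· ^ m) (node_mul_exp hlam hδ hm hM n)
  simp only [mul_pow, ← Complex.exp_nat_mul] at h
  have h1 : (m : ℂ) * -(Complex.I * (2 * (Real.pi : ℂ) * (n : ℂ) / (m : ℂ))) =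
      ((-(n : ℤ) : ℤ) : ℂ) * (2 * Real.pi * Complex.I) := by
    push_cast
    field_simp
  rw [h1, Complex.exp_int_mul_two_pi_mul_I, mul_one] at h
  rw [rate_eq_mul_one_sub_node hlam.ne']
  have h2 : -((lam : ℂ) * (1 - node m lam M δ n) * M) =
      m * -(δ : ℂ) + -(m * -(δ * node m lam M δ n)) := by
    linear_combination (-(1 - node m lam M δ n)) * hM'
  rw [h2, Complex.exp_add, ← h, mul_assoc, ← Complex.exp_add, add_neg_cancel, Complex.exp_zero,
    mul_one]

/-- A node determines its root of unity through `node_mul_exp`, and these roots are distinct for n <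
m. -/
lemma node_injective (hlam : 0 < lam) (hδ : 1 < δ) (hm : 0 < m) (hM : lam * M = m * δ) :
    Function.Injective (node m lam M δ) := by
  intro n n' h
  have h1 := node_mul_exp hlam hδ hm hM n
  rw [h, node_mul_exp hlam hδ hm hM n'] at h1
  have h2 := mul_left_cancel₀ (Complex.exp_ne_zero _) h1
  rw [Complex.exp_neg, Complex.exp_neg, inv_inj] at h2
  have hm' : m ≠ 0 := hm.ne'
  have hprim := Complex.isPrimitiveRoot_exp m hm'
  have key : ∀ k : ℕ, Complex.exp (Complex.I * (2 * (Real.pi : ℂ) * (k : ℂ) / (m : ℂ))) =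
      Complex.exp (2 * Real.pi * Complex.I / m) ^ k := by
    intro k
    rw [← Complex.exp_nat_mul]
    congr 1
    ring
  rw [key, key] at h2
  exact Fin.ext (hprim.pow_inj n.2 n'.2 h2.symm)

lemma coeffMatrix_eq_vandermonde_transpose :
    coeffMatrix m lam M δ = (Matrix.vandermonde (node m lam M δ))ᵀ := by
  ext s n
  rfl

lemma isUnit_coeffMatrix (hlam : 0 < lam) (hδ : 1 < δ) (hm : 0 < m) (hM : lam * M = m * δ) :
    IsUnit (coeffMatrix m lam M δ) := by
  rw [Matrix.isUnit_iff_isUnit_det, coeffMatrix_eq_vandermonde_transpose, Matrix.det_transpose,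
    isUnit_iff_ne_zero]
  exact Matrix.det_vandermonde_ne_zero_iff.2 (node_injective hlam hδ hm hM)

lemma sum_coeff_mul_node_pow {c : Fin m → ℂ} (hc : coeffMatrix m lam M δ *ᵥ c = 1) {s : ℕ}
    (hs : s < m) : ∑ n, c n * node m lam M δ n ^ s = 1 := by
  have := congrFun hc ⟨s, hs⟩
  simp only [Matrix.mulVec, dotProduct, coeffMatrix, Matrix.of_apply, Pi.one_apply] at this
  rw [← this]
  exact Finset.sum_congr rfl fun n _ => mul_comm _ _

lemma le_re_rate (hlam : 0 < lam) (hδ : 1 < δ) (hm : 0 < m) (hM : lam * M = m * δ) (n : Fin m) :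
    lam * (1 - 1 / δ) ≤ (rate m lam M δ n).re := by
  rw [rate_eq_mul_one_sub_node hlam.ne', Complex.re_ofReal_mul, Complex.sub_re, Complex.one_re]
  gcongr
  exact (Complex.re_le_norm _).trans (norm_node_lt hlam hδ hm hM n).le

end Node

/-! ### The Erlang density and the integral equation of the stored energy -/

/-- The Erlang density of shape `k + 1` with rate `a`, continued analytically. -/
noncomputable def erlangDensity (k : ℕ) (a : ℝ) (u : ℝ) : ℝ :=
  a ^ (k + 1) * u ^ k / k.factorial * Real.exp (-(a * u))

lemma continuous_erlangDensity (k : ℕ) (a : ℝ) : Continuous (erlangDensity k a) := by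
  unfold erlangDensity
  fun_prop

lemma erlangDensity_nonneg (k : ℕ) {a u : ℝ} (ha : 0 ≤ a) (hu : 0 ≤ u) :
    0 ≤ erlangDensity k a u := by
  unfold erlangDensity
  positivity

/-- The derivative telescopes over s. The rate is complex because the formula is later used at λr
with r a node. -/
lemma hasDerivAt_erlang_tail (k : ℕ) (a : ℂ) (u : ℝ) :
    HasDerivAt (fun u : ℝ => -∑ s ∈ Finset.range (k + 1),
        (a * u) ^ s / s.factorial * Complex.exp (-(a * u)))
      (a ^ (k + 1) * u ^ k / k.factorial * Complex.exp (-(a * u))) u := by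
  have hu : HasDerivAt (fun u : ℝ => a * (u : ℂ)) a u := by
    simpa using (Complex.ofRealCLM.hasDerivAt (x := u)).const_mul a
  have he : HasDerivAt (fun u : ℝ => Complex.exp (-(a * u)))
      (Complex.exp (-(a * u)) * -a) u := hu.neg.cexp
  induction k with
  | zero =>
    simp only [zero_add, Finset.sum_range_one, pow_zero, Nat.factorial_zero, Nat.cast_one,
      div_one, one_mul, pow_one, mul_one]
    convert! he.neg using 1
    ring
  | succ k ih =>
    have hs := (((hu.fun_pow (k + 1)).div_const ((k + 1).factorial : ℂ)).mul he)
    have := ih.sub hs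
    convert! this using 1
    · funext v
      simp only [Pi.sub_apply, Pi.mul_apply]
      rw [Finset.sum_range_succ]
      ring
    · have h1 : ((k + 1).factorial : ℂ) ≠ 0 := by exact_mod_cast (k + 1).factorial_ne_zero
      have h2 : (k.factorial : ℂ) ≠ 0 := by exact_mod_cast k.factorial_ne_zero
      have h4 : (k : ℂ) + 1 ≠ 0 := by exact_mod_cast k.succ_ne_zero
      have h3 : ((k + 1).factorial : ℂ) = (k + 1) * k.factorial := by
        rw [Nat.factorial_succ]; push_cast; ring
      rw [h3]
      simp only [Nat.add_sub_cancel]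
      push_cast
      field_simp
      ring

lemma integral_erlang (k : ℕ) (a : ℂ) (x : ℝ) :
    ∫ u in (0 : ℝ)..x, a ^ (k + 1) * (u : ℂ) ^ k / k.factorial * Complex.exp (-(a * u)) =
      1 - ∑ s ∈ Finset.range (k + 1), (a * x) ^ s / s.factorial * Complex.exp (-(a * x)) := by
  rw [intervalIntegral.integral_eq_sub_of_hasDerivAt
    (fun u _ => hasDerivAt_erlang_tail k a u)
    (Continuous.intervalIntegrable (by fun_prop) _ _)]
  rw [Finset.sum_range_succ' (n := k)
    (f := fun s => (a * ((0 : ℝ) : ℂ)) ^ s / s.factorial * Complex.exp (-(a * ((0 : ℝ) : ℂ))))]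
  simp
  ring

lemma integral_erlangDensity (k : ℕ) (a x : ℝ) :
    ∫ u in (0 : ℝ)..x, erlangDensity k a u =
      1 - ∑ s ∈ Finset.range (k + 1), (a * x) ^ s / s.factorial * Real.exp (-(a * x)) := by
  have := integral_erlang k (a : ℂ) x
  rw [← Complex.ofReal_inj]
  push_cast
  rw [← this, ← intervalIntegral.integral_ofReal]
  congr 1
  funext u
  simp [erlangDensity]

lemma integral_erlangDensity_le_one (k : ℕ) {a x : ℝ} (ha : 0 ≤ a) (hx : 0 ≤ x) :
    ∫ u in (0 : ℝ)..x, erlangDensity k a u ≤ 1 := by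
  rw [integral_erlangDensity, sub_le_self_iff]
  positivity

/-- The iterates, started from the constant `1`, of the integral operator that maps the cdf of the
stored energy to its cdf one slot later. -/
noncomputable def storageCdf (k : ℕ) (lam M : ℝ) : ℕ → ℝ → ℝ
  | 0 => fun _ => 1
  | i + 1 => fun x => ∫ u in (0 : ℝ)..x, erlangDensity k lam u * storageCdf k lam M i (x - u + M)

lemma continuous_storageCdf (k : ℕ) (lam M : ℝ) (i : ℕ) : Continuous (storageCdf k lam M i) := by
  induction i with
  | zero => exact continuous_const
  | succ i ih =>
    refine intervalIntegral.continuous_parametric_intervalIntegral_of_continuous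
      (f := fun x u => erlangDensity k lam u * storageCdf k lam M i (x - u + M)) ?_ continuous_id
    have := continuous_erlangDensity k lam
    simp only [Function.uncurry_def]
    fun_prop

/-- The kernel is nonnegative, and increasing x enlarges both the integration range and the argument
x - u + M, which stays nonnegative. -/
lemma storageCdf_nonneg_and_mono (k : ℕ) {lam M : ℝ} (hlam : 0 ≤ lam) (hM : 0 ≤ M) (i : ℕ) :
    (∀ x, 0 ≤ x → 0 ≤ storageCdf k lam M i x) ∧
      ∀ x y, 0 ≤ x → x ≤ y → storageCdf k lam M i x ≤ storageCdf k lam M i y := by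
  induction i with
  | zero => exact ⟨fun _ _ => zero_le_one, fun _ _ _ _ => le_rfl⟩
  | succ i ih =>
    have hcont : ∀ x, Continuous fun u =>
        erlangDensity k lam u * storageCdf k lam M i (x - u + M) := fun x => by
      have h1 := continuous_erlangDensity k lam
      have h2 := continuous_storageCdf k lam M i
      fun_prop
    refine ⟨fun x hx => intervalIntegral.integral_nonneg hx fun u hu =>
      mul_nonneg (erlangDensity_nonneg k hlam hu.1) (ih.1 _ (by linarith [hu.2])),
      fun x y hx hxy => ?_⟩
    calc ∫ u in (0 : ℝ)..x, erlangDensity k lam u * storageCdf k lam M i (x - u + M)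
        ≤ ∫ u in (0 : ℝ)..x, erlangDensity k lam u * storageCdf k lam M i (y - u + M) := by
          refine intervalIntegral.integral_mono_on hx ((hcont x).intervalIntegrable _ _)
            ((hcont y).intervalIntegrable _ _) fun u hu => ?_
          exact mul_le_mul_of_nonneg_left (ih.2 _ _ (by linarith [hu.2]) (by linarith))
            (erlangDensity_nonneg k hlam hu.1)
      _ ≤ (∫ u in (0 : ℝ)..x, erlangDensity k lam u * storageCdf k lam M i (y - u + M)) +
          ∫ u in x..y, erlangDensity k lam u * storageCdf k lam M i (y - u + M) := by
          refine le_add_of_nonneg_right (intervalIntegral.integral_nonneg hxy fun u hu => ?_)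
          exact mul_nonneg (erlangDensity_nonneg k hlam (hx.trans hu.1))
            (ih.1 _ (by linarith [hu.2]))
      _ = ∫ u in (0 : ℝ)..y, erlangDensity k lam u * storageCdf k lam M i (y - u + M) :=
          intervalIntegral.integral_add_adjacent_intervals ((hcont y).intervalIntegrable _ _)
            ((hcont y).intervalIntegrable _ _)

/-- Exponential tilting: e^{θu} times the Erlang density of rate λ is δ^{k+1} times the one of rate
λ/δ, whose mass is at most 1. -/
lemma norm_integral_erlangDensity_mul_le (k : ℕ) {lam M δ K x : ℝ} (hlam : 0 ≤ lam) (hM : 0 ≤ M)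
    (hδ : 0 < δ) (hx : 0 ≤ x) {E : ℝ → ℂ}
    (hE : ∀ y, 0 ≤ y → ‖E y‖ ≤ K * Real.exp (-(lam * (1 - 1 / δ) * y))) :
    ‖∫ u in (0 : ℝ)..x, (erlangDensity k lam u : ℂ) * E (x - u + M)‖ ≤
      K * (δ ^ (k + 1) * Real.exp (-(lam * (1 - 1 / δ) * M))) *
        Real.exp (-(lam * (1 - 1 / δ) * x)) := by
  set θ := lam * (1 - 1 / δ) with hθ
  have hK : 0 ≤ K :=
    nonneg_of_mul_nonneg_left ((norm_nonneg _).trans (hE 0 le_rfl)) (Real.exp_pos _)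
  have hpt : ∀ u ∈ Ioc 0 x, ‖(erlangDensity k lam u : ℂ) * E (x - u + M)‖ ≤
      K * (δ ^ (k + 1) * Real.exp (-(θ * M))) * Real.exp (-(θ * x)) *
        erlangDensity k (lam / δ) u := by
    intro u hu
    rw [norm_mul, Complex.norm_real, Real.norm_of_nonneg (erlangDensity_nonneg k hlam hu.1.le)]
    calc erlangDensity k lam u * ‖E (x - u + M)‖
        ≤ erlangDensity k lam u * (K * Real.exp (-(θ * (x - u + M)))) :=
          mul_le_mul_of_nonneg_left (hE _ (by linarith [hu.2]))
            (erlangDensity_nonneg k hlam hu.1.le)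
      _ = _ := by
        have h1 : Real.exp (-(lam * u)) * Real.exp (-(θ * (x - u + M))) =
            Real.exp (-(θ * M)) * Real.exp (-(θ * x)) * Real.exp (-(lam / δ * u)) := by
          rw [← Real.exp_add, ← Real.exp_add, ← Real.exp_add]
          congr 1
          rw [hθ]
          field_simp
          ring
        have h2 : lam ^ (k + 1) = δ ^ (k + 1) * (lam / δ) ^ (k + 1) := by
          rw [← mul_pow, mul_div_cancel₀ _ hδ.ne']
        unfold erlangDensity
        rw [h2]
        linear_combination
          (δ ^ (k + 1) * (lam / δ) ^ (k + 1) * u ^ k / k.factorial * K) * h1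
  calc _ ≤ ∫ u in (0 : ℝ)..x, K * (δ ^ (k + 1) * Real.exp (-(θ * M))) * Real.exp (-(θ * x)) *
        erlangDensity k (lam / δ) u :=
        intervalIntegral.norm_integral_le_of_norm_le hx (ae_of_all _ hpt)
          (((continuous_erlangDensity k _).const_mul _).intervalIntegrable _ _)
    _ = K * (δ ^ (k + 1) * Real.exp (-(θ * M))) * Real.exp (-(θ * x)) *
        ∫ u in (0 : ℝ)..x, erlangDensity k (lam / δ) u :=
        intervalIntegral.integral_const_mul _ _
    _ ≤ _ := mul_le_of_le_one_right (by positivity)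
        (integral_erlangDensity_le_one k (by positivity) hx)

lemma pow_mul_exp_neg_lt_one {k : ℕ} {lam M δ : ℝ} (hδ : 1 < δ)
    (hM : lam * M = ((k + 1 : ℕ) : ℝ) * δ) :
    δ ^ (k + 1) * Real.exp (-(lam * (1 - 1 / δ) * M)) < 1 := by
  have hδ0 : δ ≠ 0 := by linarith
  have h1 : -(lam * (1 - 1 / δ) * M) = ((k + 1 : ℕ) : ℝ) * (1 - δ) := by
    have : lam * (1 - 1 / δ) * M = (1 - 1 / δ) * (lam * M) := by ring
    rw [this, hM]
    field_simp
    ring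
  rw [h1, Real.exp_nat_mul, ← mul_pow]
  refine pow_lt_one₀ (by positivity) ?_ k.succ_ne_zero
  calc δ * Real.exp (1 - δ) = δ * Real.exp (-δ) * Real.exp 1 := by
        rw [mul_assoc, ← Real.exp_add]; congr 2; ring
    _ < Real.exp (-1) * Real.exp 1 := by gcongr; exact mul_exp_neg_lt hδ
    _ = 1 := by rw [← Real.exp_add]; simp

/-- The exponentials combine to e^{-λ(1-r)x} e^{-λru}, and the power of r turns the integrand into
an Erlang density of complex rate λr. -/
lemma integral_erlangDensity_mul_exp (k : ℕ) (lam : ℝ) (r : ℂ) (x : ℝ) :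
    ∫ u in (0 : ℝ)..x, (erlangDensity k lam u : ℂ) *
        (r ^ (k + 1) * Complex.exp (-(lam * (1 - r) * (x - u : ℝ)))) =
      Complex.exp (-(lam * (1 - r) * x)) - ∑ s ∈ Finset.range (k + 1),
        (lam * x) ^ s / s.factorial * Complex.exp (-(lam * x)) * r ^ s := by
  have h : ∀ u : ℝ, (erlangDensity k lam u : ℂ) *
        (r ^ (k + 1) * Complex.exp (-(lam * (1 - r) * (x - u : ℝ)))) =
      Complex.exp (-(lam * (1 - r) * x)) * ((lam * r) ^ (k + 1) * (u : ℂ) ^ k / k.factorial *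
        Complex.exp (-(lam * r * u))) := by
    intro u
    have h1 : Complex.exp (-(lam * u)) * Complex.exp (-(lam * (1 - r) * (x - u : ℝ))) =
        Complex.exp (-(lam * (1 - r) * x)) * Complex.exp (-(lam * r * u)) := by
      rw [← Complex.exp_add, ← Complex.exp_add]
      congr 1
      push_cast
      ring
    simp only [erlangDensity]
    push_cast at h1 ⊢
    linear_combination (lam ^ (k + 1) * u ^ k / k.factorial * r ^ (k + 1)) * h1
  simp_rw [h]
  rw [intervalIntegral.integral_const_mul, integral_erlang, mul_sub, mul_one, Finset.mul_sum]
  congr 1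
  refine Finset.sum_congr rfl fun s _ => ?_
  have h2 : Complex.exp (-(lam * (1 - r) * x)) * Complex.exp (-(lam * r * x)) =
      Complex.exp (-(lam * x)) := by
    rw [← Complex.exp_add]
    congr 1
    ring
  rw [← h2]
  ring

/-! ### The candidate cdf -/

/-- The cdf `1 - ∑ cₙ exp (-λₙ x)` as a complex valued function. -/
noncomputable def expSumCdf {m : ℕ} (lam M δ : ℝ) (c : Fin m → ℂ) (x : ℝ) : ℂ :=
  1 - ∑ n, c n * Complex.exp (-(rate m lam M δ n * (x : ℂ)))

lemma continuous_expSumCdf {m : ℕ} (lam M δ : ℝ) (c : Fin m → ℂ) :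
    Continuous (expSumCdf lam M δ c) := by
  unfold expSumCdf
  fun_prop

lemma hasDerivAt_expSumCdf {m : ℕ} (lam M δ : ℝ) (c : Fin m → ℂ) (x : ℝ) :
    HasDerivAt (expSumCdf lam M δ c) (∑ n, rate m lam M δ n * c n *
      Complex.exp (-(rate m lam M δ n * (x : ℂ)))) x := by
  have h : ∀ n ∈ Finset.univ, HasDerivAt
      (fun x : ℝ => c n * Complex.exp (-(rate m lam M δ n * (x : ℂ))))
      (-(rate m lam M δ n * c n * Complex.exp (-(rate m lam M δ n * (x : ℂ))))) x := by
    intro n _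
    have hu : HasDerivAt (fun u : ℝ => rate m lam M δ n * (u : ℂ)) (rate m lam M δ n) x := by
      simpa using (Complex.ofRealCLM.hasDerivAt (x := x)).const_mul (rate m lam M δ n)
    convert! (hu.neg.cexp).const_mul (c n) using 1
    simp only [Pi.neg_apply]
    ring
  have := (HasDerivAt.fun_sum h).const_sub 1
  rw [Finset.sum_neg_distrib, neg_neg] at this
  exact this

section ExpSum

variable {k : ℕ} {lam M δ : ℝ} {c : Fin (k + 1) → ℂ}

lemma expSumCdf_eq_integral (hlam : 0 < lam) (hδ : 1 < δ)
    (hM : lam * M = ((k + 1 : ℕ) : ℝ) * δ) (hc : coeffMatrix (k + 1) lam M δ *ᵥ c = 1) (x : ℝ) :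
    expSumCdf lam M δ c x =
      ∫ u in (0 : ℝ)..x, (erlangDensity k lam u : ℂ) * expSumCdf lam M δ c (x - u + M) := by
  have hρ : Continuous fun u => (erlangDensity k lam u : ℂ) :=
    Complex.continuous_ofReal.comp (continuous_erlangDensity k lam)
  have h1 : ∀ u : ℝ, (erlangDensity k lam u : ℂ) * expSumCdf lam M δ c (x - u + M) =
      (erlangDensity k lam u : ℂ) - ∑ n, c n * ((erlangDensity k lam u : ℂ) *
        (node (k + 1) lam M δ n ^ (k + 1) *
          Complex.exp (-(lam * (1 - node (k + 1) lam M δ n) * (x - u : ℝ))))) := by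
    intro u
    rw [expSumCdf, mul_sub, mul_one, Finset.mul_sum]
    congr 1
    refine Finset.sum_congr rfl fun n _ => ?_
    rw [node_pow hlam hδ k.succ_pos hM, ← rate_eq_mul_one_sub_node hlam.ne', ← Complex.exp_add]
    rw [mul_left_comm]
    congr 3
    push_cast
    ring
  simp_rw [h1]
  rw [intervalIntegral.integral_sub (hρ.intervalIntegrable _ _)
    (Continuous.intervalIntegrable (by fun_prop) _ _),
    intervalIntegral.integral_finsetSum
      fun n _ => Continuous.intervalIntegrable (by fun_prop) _ _]
  simp_rw [intervalIntegral.integral_const_mul, integral_erlangDensity_mul_exp,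
    intervalIntegral.integral_ofReal, integral_erlangDensity, fun n => mul_sub (c n),
    Finset.sum_sub_distrib]
  have h2 : ∑ n, c n * ∑ s ∈ Finset.range (k + 1), ((lam : ℂ) * x) ^ s / s.factorial *
      Complex.exp (-(lam * x)) * node (k + 1) lam M δ n ^ s =
      ∑ s ∈ Finset.range (k + 1), ((lam : ℂ) * x) ^ s / s.factorial *
        Complex.exp (-(lam * x)) := by
    simp_rw [Finset.mul_sum]
    rw [Finset.sum_comm]
    -- Row s of `A c = 1` replaces the weighted sum of node powers by 1.
    refine Finset.sum_congr rfl fun s hs => ?_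
    conv_rhs => rw [← mul_one (_ * _), ← sum_coeff_mul_node_pow hc (Finset.mem_range.1 hs),
      Finset.mul_sum]
    exact Finset.sum_congr rfl fun n _ => by ring
  rw [h2, expSumCdf]
  simp_rw [rate_eq_mul_one_sub_node hlam.ne' M δ]
  push_cast
  ring

lemma norm_one_sub_expSumCdf_le (hlam : 0 < lam) (hδ : 1 < δ)
    (hM : lam * M = ((k + 1 : ℕ) : ℝ) * δ) (c : Fin (k + 1) → ℂ) {x : ℝ} (hx : 0 ≤ x) :
    ‖1 - expSumCdf lam M δ c x‖ ≤ (∑ n, ‖c n‖) * Real.exp (-(lam * (1 - 1 / δ) * x)) := by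
  rw [expSumCdf, sub_sub_cancel, Finset.sum_mul]
  refine (norm_sum_le _ _).trans (Finset.sum_le_sum fun n _ => ?_)
  rw [norm_mul, Complex.norm_exp, Complex.neg_re, Complex.re_mul_ofReal]
  have := le_re_rate hlam hδ k.succ_pos hM n
  gcongr

/-- The operator fixes G, so each error is the operator applied to the previous one and gains the
contraction factor; the initial error is 1 - G. -/
lemma norm_storageCdf_sub_le (hlam : 0 < lam) (hδ : 1 < δ)
    (hM : lam * M = ((k + 1 : ℕ) : ℝ) * δ) (hc : coeffMatrix (k + 1) lam M δ *ᵥ c = 1) (i : ℕ) :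
    ∀ x, 0 ≤ x → ‖(storageCdf k lam M i x : ℂ) - expSumCdf lam M δ c x‖ ≤
      (∑ n, ‖c n‖) * (δ ^ (k + 1) * Real.exp (-(lam * (1 - 1 / δ) * M))) ^ i *
        Real.exp (-(lam * (1 - 1 / δ) * x)) := by
  have hM0 : 0 ≤ M := by
    refine (pos_of_mul_pos_right (b := M) (a := lam) ?_ hlam.le).le
    rw [hM]; positivity
  induction i with
  | zero =>
    intro x hx
    simpa [storageCdf] using norm_one_sub_expSumCdf_le hlam hδ hM c hx
  | succ i ih =>
    intro x hx
    have hρ : Continuous fun u => (erlangDensity k lam u : ℂ) :=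
      Complex.continuous_ofReal.comp (continuous_erlangDensity k lam)
    have hF : Continuous fun u => (storageCdf k lam M i u : ℂ) :=
      Complex.continuous_ofReal.comp (continuous_storageCdf k lam M i)
    have hG := continuous_expSumCdf lam M δ c
    have hρ' := continuous_erlangDensity k lam
    have hF' := continuous_storageCdf k lam M i
    have hint : Continuous fun u =>
        ((erlangDensity k lam u * storageCdf k lam M i (x - u + M) : ℝ) : ℂ) := by
      fun_prop
    have heq : (storageCdf k lam M (i + 1) x : ℂ) - expSumCdf lam M δ c x =
        ∫ u in (0 : ℝ)..x, (erlangDensity k lam u : ℂ) *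
          ((fun y => (storageCdf k lam M i y : ℂ) - expSumCdf lam M δ c y) (x - u + M)) := by
      rw [expSumCdf_eq_integral hlam hδ hM hc x, storageCdf, ← intervalIntegral.integral_ofReal,
        ← intervalIntegral.integral_sub (hint.intervalIntegrable _ _)
          (Continuous.intervalIntegrable (by fun_prop) _ _)]
      congr 1
      funext u
      push_cast
      ring
    rw [heq]
    refine (norm_integral_erlangDensity_mul_le k hlam.le hM0 (by linarith) hx ih).trans_eq ?_
    ring

lemma tendsto_storageCdf (hlam : 0 < lam) (hδ : 1 < δ)
    (hM : lam * M = ((k + 1 : ℕ) : ℝ) * δ) (hc : coeffMatrix (k + 1) lam M δ *ᵥ c = 1)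
    {x : ℝ} (hx : 0 ≤ x) :
    Tendsto (fun i => (storageCdf k lam M i x : ℂ)) atTop (nhds (expSumCdf lam M δ c x)) := by
  rw [tendsto_iff_norm_sub_tendsto_zero]
  refine squeeze_zero (fun _ => norm_nonneg _)
    (fun i => norm_storageCdf_sub_le hlam hδ hM hc i x hx) ?_
  have := tendsto_pow_atTop_nhds_zero_of_lt_one (by positivity) (pow_mul_exp_neg_lt_one hδ hM)
  simpa using (this.const_mul (∑ n, ‖c n‖)).mul_const (Real.exp (-(lam * (1 - 1 / δ) * x)))

lemma expSumCdf_re_eq (hlam : 0 < lam) (hδ : 1 < δ)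
    (hM : lam * M = ((k + 1 : ℕ) : ℝ) * δ) (hc : coeffMatrix (k + 1) lam M δ *ᵥ c = 1)
    {x : ℝ} (hx : 0 ≤ x) : ((expSumCdf lam M δ c x).re : ℂ) = expSumCdf lam M δ c x := by
  have h := tendsto_storageCdf hlam hδ hM hc hx
  have h1 := (Complex.continuous_im.tendsto _).comp h
  have h2 : (expSumCdf lam M δ c x).im = 0 := by
    refine tendsto_nhds_unique h1 ?_
    simp [Function.comp_def]
  exact Complex.ext (by simp) (by simp [h2])

lemma monotoneOn_expSumCdf_re (hlam : 0 < lam) (hδ : 1 < δ)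
    (hM : lam * M = ((k + 1 : ℕ) : ℝ) * δ) (hc : coeffMatrix (k + 1) lam M δ *ᵥ c = 1) :
    MonotoneOn (fun x => (expSumCdf lam M δ c x).re) (Ici 0) := by
  have hM0 : 0 ≤ M := by
    refine (pos_of_mul_pos_right (b := M) (a := lam) ?_ hlam.le).le
    rw [hM]; positivity
  have h : ∀ x, 0 ≤ x → Tendsto (fun i => storageCdf k lam M i x) atTop
      (nhds (expSumCdf lam M δ c x).re) := fun x hx => by
    simpa [Function.comp_def] using
      (Complex.continuous_re.tendsto _).comp (tendsto_storageCdf hlam hδ hM hc hx)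
  intro x hx y hy hxy
  exact le_of_tendsto_of_tendsto' (h x hx) (h y hy)
    fun i => (storageCdf_nonneg_and_mono k hlam.le hM0 i).2 x y hx hxy

lemma expSumCdf_zero (hc : coeffMatrix (k + 1) lam M δ *ᵥ c = 1) : expSumCdf lam M δ c 0 = 0 := by
  have := sum_coeff_mul_node_pow hc k.succ_pos
  simp only [pow_zero, mul_one] at this
  simp [expSumCdf, this]

lemma tendsto_expSumCdf_re (hlam : 0 < lam) (hδ : 1 < δ)
    (hM : lam * M = ((k + 1 : ℕ) : ℝ) * δ) (c : Fin (k + 1) → ℂ) :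
    Tendsto (fun x => (expSumCdf lam M δ c x).re) atTop (nhds 1) := by
  have hθ : 0 < lam * (1 - 1 / δ) := by
    refine mul_pos hlam (sub_pos.2 ?_)
    rw [div_lt_one (by linarith)]
    exact hδ
  have h1 : Tendsto (fun x => (∑ n, ‖c n‖) * Real.exp (-(lam * (1 - 1 / δ) * x))) atTop
      (nhds 0) := by
    have := Real.tendsto_exp_neg_atTop_nhds_zero.comp (tendsto_id.const_mul_atTop hθ)
    simpa using this.const_mul (∑ n, ‖c n‖)
  have h2 : Tendsto (fun x => 1 - expSumCdf lam M δ c x) atTop (nhds 0) :=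
    squeeze_zero_norm' ((eventually_ge_atTop 0).mono
      fun x hx => norm_one_sub_expSumCdf_le hlam hδ hM c hx) h1
  have h3 : Tendsto (expSumCdf lam M δ c) atTop (nhds 1) := by simpa using h2.const_sub 1
  simpa [Function.comp_def] using (Complex.continuous_re.tendsto _).comp h3

end ExpSum

/-! ### The gamma law -/

lemma gammaPDF_eq_erlangDensity (k : ℕ) (lam : ℝ) {u : ℝ} (hu : 0 ≤ u) :
    gammaPDF ((k + 1 : ℕ) : ℝ) lam u = ENNReal.ofReal (erlangDensity k lam u) := by
  rw [gammaPDF_of_nonneg hu, erlangDensity, Real.rpow_natCast]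
  have h1 : Real.Gamma ((k + 1 : ℕ) : ℝ) = k.factorial := by
    push_cast
    exact Real.Gamma_nat_eq_factorial k
  have h2 : ((k + 1 : ℕ) : ℝ) - 1 = (k : ℝ) := by push_cast; ring
  rw [h1, h2, Real.rpow_natCast]
  congr 1
  ring

lemma integral_id_gammaMeasure {a r : ℝ} (ha : 0 < a) (hr : 0 < r) :
    ∫ x, x ∂(gammaMeasure a r) = a / r := by
  have hmeas : Measurable (gammaPDF a r) := (measurable_gammaPDFReal a r).ennreal_ofReal
  rw [gammaMeasure, integral_withDensity_eq_integral_toReal_smul hmeas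
    (ae_of_all _ fun _ => ENNReal.ofReal_lt_top),
    ← setIntegral_eq_integral_of_forall_compl_eq_zero (s := Ioi 0)]
  · have h : ∀ x ∈ Ioi (0 : ℝ), (gammaPDF a r x).toReal • x =
        r ^ a / Real.Gamma a * (x ^ (a + 1 - 1) * Real.exp (-(r * x))) := by
      intro x hx
      rw [gammaPDF, ENNReal.toReal_ofReal (gammaPDFReal_nonneg ha hr x), gammaPDFReal,
        if_pos (le_of_lt hx), smul_eq_mul, add_sub_right_comm, Real.rpow_add_one (ne_of_gt hx)]
      ring
    rw [setIntegral_congr_fun measurableSet_Ioi h, integral_const_mul,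
      Real.integral_rpow_mul_exp_neg_mul_Ioi (by linarith) hr, Real.Gamma_add_one ha.ne',
      Real.div_rpow zero_le_one hr.le, Real.one_rpow, Real.rpow_add_one hr.ne']
    have := (Real.rpow_pos_of_pos hr a).ne'
    have := (Real.Gamma_pos_of_pos ha).ne'
    field_simp
  · intro x hx
    rcases (not_lt.1 (show ¬ 0 < x from hx)).eq_or_lt with h | h
    · simp [h]
    · simp [gammaPDF_of_neg h]

lemma integrable_id_gammaMeasure {a r : ℝ} (ha : 0 < a) (hr : 0 < r) :
    Integrable (fun x => x) (gammaMeasure a r) := by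
  -- The integral of a nonintegrable function is 0 by convention, so a nonzero mean already gives
  -- integrability.
  refine Integrable.of_integral_ne_zero ?_
  rw [integral_id_gammaMeasure ha hr]
  positivity

/-! ### The stationary law -/

/-- The density `∑ λₙ cₙ exp (-λₙ x)`. -/
noncomputable def expSumDensity {m : ℕ} (lam M δ : ℝ) (c : Fin m → ℂ) (x : ℝ) : ℝ :=
  (∑ n, rate m lam M δ n * c n * Complex.exp (-(rate m lam M δ n * (x : ℂ)))).re

/-- The law on `(0, ∞)` with density `∑ λₙ cₙ exp (-λₙ x)`. -/
noncomputable def expSumLaw {m : ℕ} (lam M δ : ℝ) (c : Fin m → ℂ) : Measure ℝ :=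
  (volume.restrict (Ioi 0)).withDensity fun x => ENNReal.ofReal (expSumDensity lam M δ c x)

lemma hasDerivAt_expSumCdf_re {m : ℕ} (lam M δ : ℝ) (c : Fin m → ℂ) (x : ℝ) :
    HasDerivAt (fun x => (expSumCdf lam M δ c x).re) (expSumDensity lam M δ c x) x :=
  Complex.reCLM.hasFDerivAt.comp_hasDerivAt x (hasDerivAt_expSumCdf lam M δ c x)

lemma continuous_expSumDensity {m : ℕ} (lam M δ : ℝ) (c : Fin m → ℂ) :
    Continuous (expSumDensity lam M δ c) := by
  unfold expSumDensity
  fun_prop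

section Law

variable {k : ℕ} {lam M δ : ℝ} {c : Fin (k + 1) → ℂ}

lemma expSumDensity_nonneg (hlam : 0 < lam) (hδ : 1 < δ)
    (hM : lam * M = ((k + 1 : ℕ) : ℝ) * δ) (hc : coeffMatrix (k + 1) lam M δ *ᵥ c = 1)
    {x : ℝ} (hx : 0 < x) : 0 ≤ expSumDensity lam M δ c x := by
  have h := (monotoneOn_expSumCdf_re hlam hδ hM hc).derivWithin_nonneg (x := x)
  rwa [derivWithin_of_mem_nhds (Ici_mem_nhds hx), (hasDerivAt_expSumCdf_re lam M δ c x).deriv] at h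

lemma ofReal_expSumDensity (hlam : 0 < lam) (hδ : 1 < δ)
    (hM : lam * M = ((k + 1 : ℕ) : ℝ) * δ) (hc : coeffMatrix (k + 1) lam M δ *ᵥ c = 1)
    {x : ℝ} (hx : 0 < x) : (expSumDensity lam M δ c x : ℂ) =
      ∑ n, rate (k + 1) lam M δ n * c n *
        Complex.exp (-(rate (k + 1) lam M δ n * (x : ℂ))) := by
  have h1 : HasDerivAt (fun x => ((expSumCdf lam M δ c x).re : ℂ))
      (expSumDensity lam M δ c x : ℂ) x := (hasDerivAt_expSumCdf_re lam M δ c x).ofReal_comp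
  refine (h1.congr_of_eventuallyEq ?_).unique (hasDerivAt_expSumCdf lam M δ c x)
  filter_upwards [Ioi_mem_nhds hx] with y hy
  exact (expSumCdf_re_eq hlam hδ hM hc (le_of_lt hy)).symm

lemma expSumLaw_univ (hlam : 0 < lam) (hδ : 1 < δ)
    (hM : lam * M = ((k + 1 : ℕ) : ℝ) * δ) (hc : coeffMatrix (k + 1) lam M δ *ᵥ c = 1) :
    expSumLaw lam M δ c univ = 1 := by
  have hpos : ∀ x ∈ Ioi (0 : ℝ), 0 ≤ expSumDensity lam M δ c x :=
    fun x hx => expSumDensity_nonneg hlam hδ hM hc hx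
  have hlim := tendsto_expSumCdf_re hlam hδ hM c
  have hd : ∀ x ∈ Ici (0 : ℝ), HasDerivAt (fun x => (expSumCdf lam M δ c x).re)
      (expSumDensity lam M δ c x) x := fun x _ => hasDerivAt_expSumCdf_re lam M δ c x
  rw [expSumLaw, withDensity_apply _ MeasurableSet.univ, Measure.restrict_univ,
    ← ofReal_integral_eq_lintegral_ofReal (integrableOn_Ioi_deriv_of_nonneg' hd hpos hlim)
      ((ae_restrict_iff' measurableSet_Ioi).2 (ae_of_all _ hpos)),
    integral_Ioi_of_hasDerivAt_of_nonneg' hd hpos hlim, expSumCdf_zero hc]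
  simp

lemma expSumLaw_Iic_zero : expSumLaw lam M δ c (Iic 0) = 0 := by
  rw [expSumLaw, withDensity_apply _ measurableSet_Iic, Measure.restrict_restrict measurableSet_Iic,
    Iic_inter_Ioi, Ioc_self]
  simp

lemma expSumLaw_Iic_of_nonneg (hlam : 0 < lam) (hδ : 1 < δ)
    (hM : lam * M = ((k + 1 : ℕ) : ℝ) * δ) (hc : coeffMatrix (k + 1) lam M δ *ᵥ c = 1)
    {x : ℝ} (hx : 0 ≤ x) :
    expSumLaw lam M δ c (Iic x) = ENNReal.ofReal (expSumCdf lam M δ c x).re := by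
  have hpos : ∀ y ∈ Ioc 0 x, 0 ≤ expSumDensity lam M δ c y :=
    fun y hy => expSumDensity_nonneg hlam hδ hM hc hy.1
  have hint := (continuous_expSumDensity lam M δ c).intervalIntegrable 0 x (μ := volume)
  rw [expSumLaw, withDensity_apply _ measurableSet_Iic, Measure.restrict_restrict measurableSet_Iic,
    Iic_inter_Ioi, ← ofReal_integral_eq_lintegral_ofReal hint.1
      ((ae_restrict_iff' measurableSet_Ioc).2 (ae_of_all _ hpos)),
    ← intervalIntegral.integral_of_le hx, intervalIntegral.integral_eq_sub_of_hasDerivAt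
      (fun x _ => hasDerivAt_expSumCdf_re lam M δ c x) hint, expSumCdf_zero hc]
  simp

lemma expSumCdf_re_eq_integral (hlam : 0 < lam) (hδ : 1 < δ)
    (hM : lam * M = ((k + 1 : ℕ) : ℝ) * δ) (hM0 : 0 ≤ M)
    (hc : coeffMatrix (k + 1) lam M δ *ᵥ c = 1) {x : ℝ} (hx : 0 ≤ x) :
    (expSumCdf lam M δ c x).re =
      ∫ u in (0 : ℝ)..x, erlangDensity k lam u * (expSumCdf lam M δ c (x - u + M)).re := by
  rw [← Complex.ofReal_inj, expSumCdf_re_eq hlam hδ hM hc hx, expSumCdf_eq_integral hlam hδ hM hc,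
    ← intervalIntegral.integral_ofReal]
  refine intervalIntegral.integral_congr fun u hu => ?_
  rw [uIcc_of_le hx] at hu
  simp only [Complex.ofReal_mul]
  rw [expSumCdf_re_eq hlam hδ hM hc (by linarith [hu.2])]

/-- The law with density `∑ λₙ cₙ exp (-λₙ x)` is invariant under one slot of the storage chain. -/
lemma map_storage_expSumLaw (hlam : 0 < lam) (hδ : 1 < δ)
    (hM : lam * M = ((k + 1 : ℕ) : ℝ) * δ) (hM0 : 0 ≤ M)
    (hc : coeffMatrix (k + 1) lam M δ *ᵥ c = 1) [IsProbabilityMeasure (expSumLaw lam M δ c)] :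
    ((expSumLaw lam M δ c).prod (gammaMeasure ((k + 1 : ℕ) : ℝ) lam)).map
      (fun p => max (p.1 - M) 0 + p.2) = expSumLaw lam M δ c := by
  have hξ := isProbabilityMeasure_gammaMeasure (a := ((k + 1 : ℕ) : ℝ)) (by positivity) hlam
  have hf : Measurable fun p : ℝ × ℝ => max (p.1 - M) 0 + p.2 := by fun_prop
  have hpdf : Measurable (gammaPDF ((k + 1 : ℕ) : ℝ) lam) :=
    (measurable_gammaPDFReal _ lam).ennreal_ofReal
  have hprob := Measure.isProbabilityMeasure_map (μ := (expSumLaw lam M δ c).prod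
    (gammaMeasure ((k + 1 : ℕ) : ℝ) lam)) hf.aemeasurable
  refine Measure.ext_of_Iic _ _ fun x => ?_
  have hslice : Measurable fun u => expSumLaw lam M δ c
      ((fun b => (b, u)) ⁻¹' ((fun p : ℝ × ℝ => max (p.1 - M) 0 + p.2) ⁻¹' Iic x)) :=
    measurable_measure_prodMk_right (hf measurableSet_Iic)
  rw [Measure.map_apply hf measurableSet_Iic, Measure.prod_apply_symm (hf measurableSet_Iic),
    gammaMeasure, lintegral_withDensity_eq_lintegral_mul _ hpdf hslice]
  have hpt : ∀ u, (gammaPDF ((k + 1 : ℕ) : ℝ) lam * fun u => expSumLaw lam M δ c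
      ((fun b => (b, u)) ⁻¹' ((fun p : ℝ × ℝ => max (p.1 - M) 0 + p.2) ⁻¹' Iic x))) u =
      (Icc 0 x).indicator (fun u => ENNReal.ofReal
        (erlangDensity k lam u * (expSumCdf lam M δ c (x - u + M)).re)) u := by
    intro u
    rw [Pi.mul_apply]
    rcases lt_or_ge u 0 with hu | hu
    · rw [gammaPDF_of_neg hu, zero_mul, indicator_of_notMem fun h => hu.not_ge h.1]
    rcases lt_or_ge x u with hxu | hxu
    · have : (fun b => (b, u)) ⁻¹' ((fun p : ℝ × ℝ => max (p.1 - M) 0 + p.2) ⁻¹' Iic x) = ∅ := by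
        ext b
        simp only [mem_preimage, mem_Iic, mem_empty_iff_false, iff_false, not_le]
        linarith [le_max_right (b - M) 0]
      rw [this, measure_empty, mul_zero, indicator_of_notMem fun h => hxu.not_ge h.2]
    -- For u ≤ x the truncation at 0 imposes no condition, leaving b ≤ x - u + M.
    · have : (fun b => (b, u)) ⁻¹' ((fun p : ℝ × ℝ => max (p.1 - M) 0 + p.2) ⁻¹' Iic x) =
          Iic (x - u + M) := by
        ext b
        simp only [mem_preimage, mem_Iic]
        rw [← le_sub_iff_add_le, max_le_iff, sub_le_iff_le_add]
        exact and_iff_left (sub_nonneg.2 hxu)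
      rw [this, expSumLaw_Iic_of_nonneg hlam hδ hM hc (by linarith),
        gammaPDF_eq_erlangDensity k lam hu, indicator_of_mem (show u ∈ Icc 0 x from ⟨hu, hxu⟩),
        ENNReal.ofReal_mul (erlangDensity_nonneg k hlam.le hu)]
  simp_rw [hpt]
  rw [lintegral_indicator measurableSet_Icc]
  rcases lt_or_ge x 0 with hx | hx
  · rw [Icc_eq_empty hx.not_ge, Measure.restrict_empty, lintegral_zero_measure]
    exact (measure_mono_null (Iic_subset_Iic.2 hx.le) expSumLaw_Iic_zero).symm
  · have hcont : Continuous fun u =>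
        erlangDensity k lam u * (expSumCdf lam M δ c (x - u + M)).re := by
      have h1 := continuous_erlangDensity k lam
      have h2 := continuous_expSumCdf lam M δ c
      fun_prop
    have hpos : ∀ u ∈ Ioc 0 x,
        0 ≤ erlangDensity k lam u * (expSumCdf lam M δ c (x - u + M)).re := by
      intro u hu
      refine mul_nonneg (erlangDensity_nonneg k hlam.le hu.1.le) ?_
      have hy : 0 ≤ x - u + M := by linarith [hu.2]
      simpa [expSumCdf_zero hc] using monotoneOn_expSumCdf_re hlam hδ hM hc self_mem_Ici hy hy
    rw [expSumLaw_Iic_of_nonneg hlam hδ hM hc hx, expSumCdf_re_eq_integral hlam hδ hM hM0 hc hx,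
      intervalIntegral.integral_of_le hx, ofReal_integral_eq_lintegral_ofReal
        (hcont.intervalIntegrable 0 x).1
        ((ae_restrict_iff' measurableSet_Ioc).2 (ae_of_all _ hpos)),
      setLIntegral_congr Ioc_ae_eq_Icc.symm]

end Law

/-! ### Convergence in total variation by coupling -/

lemma indepFun_prodMk_left {Ω α β γ : Type*} [MeasurableSpace Ω] [MeasurableSpace α]
    [MeasurableSpace β] [MeasurableSpace γ] {P : Measure Ω} [IsProbabilityMeasure P] {f : Ω → α}
    {g : Ω → β} {h : Ω → γ} (hf : Measurable f) (hg : Measurable g) (hh : Measurable h)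
    (h1 : IndepFun f (fun ω => (g ω, h ω)) P) (h2 : IndepFun g h P) :
    IndepFun (fun ω => (f ω, g ω)) h P := by
  have hfg : IndepFun f g P := h1.comp measurable_id measurable_fst
  have := Measure.isProbabilityMeasure_map (μ := P) hf.aemeasurable
  have := Measure.isProbabilityMeasure_map (μ := P) hg.aemeasurable
  have := Measure.isProbabilityMeasure_map (μ := P) hh.aemeasurable
  rw [indepFun_iff_map_prod_eq_prod_map_map (by fun_prop) (by fun_prop)] at h1 h2 hfg ⊢
  rw [hfg]
  refine MeasurableEquiv.prodAssoc.map_measurableEquiv_injective ?_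
  rw [Measure.prodAssoc_prod, ← h2, ← h1,
    Measure.map_map MeasurableEquiv.prodAssoc.measurable (by fun_prop)]
  rfl

lemma iIndepFun_indepFun_tail {Ω : Type*} [MeasurableSpace Ω] {P : Measure Ω} {X : ℕ → Ω → ℝ}
    (hX : ∀ i, Measurable (X i)) (h : iIndepFun X P) (i : ℕ) :
    IndepFun (X i) (fun ω j => X (i + 1 + j) ω) P := by
  have hdisj : Disjoint ({i} : Set ℕ) (Ioi i) := by simp
  have := indep_iSup_of_disjoint (fun i => (hX i).comap_le) h.iIndep hdisj
  rw [IndepFun_iff_Indep, MeasurableSpace.comap_process_pi]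
  refine indep_of_indep_of_le_left (indep_of_indep_of_le_right this ?_) ?_
  · refine iSup_le fun j => le_iSup₂_of_le (i + 1 + j) ?_ le_rfl
    simp only [mem_Ioi]
    omega
  · exact le_iSup₂_of_le i rfl le_rfl

namespace IsBestEffortStorage

variable {Ω : Type*} [MeasurableSpace Ω] {M : ℝ} {ξ π : Measure ℝ} {P : Measure Ω}
  {X B : ℕ → Ω → ℝ}

/-- The induction needs independence from the whole future sequence: one harvest is moved from the
future into the state at each step. -/
lemma indepFun_stored_harvest [IsProbabilityMeasure P] (h : IsBestEffortStorage M ξ P X B) (i : ℕ) :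
    IndepFun (B i) (fun ω j => X (i + j) ω) P := by
  have hX := h.measurable_harvest
  have hB := h.measurable_stored
  induction i with
  | zero => simpa using h.indep_init
  | succ i ih =>
    have h1 : IndepFun (B i) (fun ω => (X i ω, fun j => X (i + 1 + j) ω)) P := by
      have hφ : Measurable fun x : ℕ → ℝ => (x 0, fun j => x (j + 1)) := by fun_prop
      have := ih.comp measurable_id hφ
      convert! this using 1
      funext ω
      simp only [Function.comp_apply, add_zero, Prod.mk.injEq, true_and]
      funext j
      rw [add_assoc, add_comm 1 j]
    have h2 := indepFun_prodMk_left (hB i) (hX i) (measurable_pi_lambda _ fun j => hX _) h1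
      (iIndepFun_indepFun_tail hX h.indep_harvest i)
    have hf : Measurable fun p : ℝ × ℝ => max (p.1 - M) 0 + p.2 := by fun_prop
    refine (h2.comp hf measurable_id).congr ?_ (ae_eq_refl _)
    filter_upwards [h.storage_eq i] with ω hω
    exact hω.symm

lemma map_stored_eq_of_invariant [IsProbabilityMeasure P] (h : IsBestEffortStorage M ξ P X B)
    (hinv : (π.prod ξ).map (fun p => max (p.1 - M) 0 + p.2) = π) (h0 : P.map (B 0) = π) (i : ℕ) :
    P.map (B i) = π := by
  induction i with
  | zero => exact h0
  | succ i ih =>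
    have hX := h.measurable_harvest i
    have hB := h.measurable_stored i
    have hind : IndepFun (B i) (X i) P :=
      (h.indepFun_stored_harvest i).comp measurable_id (measurable_pi_apply 0)
    rw [indepFun_iff_map_prod_eq_prod_map_map (by fun_prop) (by fun_prop), ih,
      h.law_harvest i] at hind
    have hf : Measurable fun p : ℝ × ℝ => max (p.1 - M) 0 + p.2 := by fun_prop
    rw [Measure.map_congr (h.storage_eq i), ← hinv, ← hind, Measure.map_map hf (by fun_prop)]
    rfl

lemma ae_tendsto_average (h : IsBestEffortStorage M ξ P X B) (hξ : Integrable (fun x => x) ξ) :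
    ∀ᵐ ω ∂P, Tendsto (fun n : ℕ => (∑ i ∈ Finset.range n, X i ω) / n) atTop
      (nhds (∫ x, x ∂ξ)) := by
  have hX := h.measurable_harvest
  have hint : Integrable (X 0) P := by
    rw [← h.law_harvest 0] at hξ
    exact hξ.comp_measurable (hX 0)
  have hmean : ∫ ω, X 0 ω ∂P = ∫ x, x ∂ξ := by
    rw [← h.law_harvest 0, integral_map (hX 0).aemeasurable (by fun_prop)]
  rw [← hmean]
  exact strong_law_ae_real X hint (fun i j hij => h.indep_harvest.indepFun hij)
    fun i => ⟨(hX i).aemeasurable, (hX 0).aemeasurable, by rw [h.law_harvest, h.law_harvest]⟩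

end IsBestEffortStorage

/-- Once both paths are at most M, their next values are the same harvest. Otherwise the larger path
always exceeds M and is a walk with steps x i - M, whose average drift l - M is negative. -/
lemma eventually_eq_of_storage {M l : ℝ} {x b b' : ℕ → ℝ} (hl : l < M)
    (hx : Tendsto (fun n : ℕ => (∑ i ∈ Finset.range n, x i) / n) atTop (nhds l))
    (hb : ∀ i, b (i + 1) = max (b i - M) 0 + x i)
    (hb' : ∀ i, b' (i + 1) = max (b' i - M) 0 + x i) : ∀ᶠ i in atTop, b i = b' i := by
  suffices h : ∃ i, b i ≤ M ∧ b' i ≤ M by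
    obtain ⟨i, hi, hi'⟩ := h
    refine eventually_atTop.2 ⟨i + 1, fun j hj => ?_⟩
    induction j, hj using Nat.le_induction with
    | base => rw [hb, hb', max_eq_right (by linarith), max_eq_right (by linarith)]
    | succ j _ ih => rw [hb, hb', ih]
  by_contra! hcon
  have hgt : ∀ i, M < max (b i) (b' i) := fun i => by
    rcases le_or_gt (b i) M with h | h
    · exact lt_max_of_lt_right (hcon i h)
    · exact lt_max_of_lt_left h
  have hstep : ∀ i, max (b (i + 1)) (b' (i + 1)) = max (b i) (b' i) - M + x i := fun i => by
    have := hgt i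
    rw [hb, hb', max_add_add_right, max_max_max_comm, max_self, max_sub_sub_right,
      max_eq_left (by linarith)]
  have hsum : ∀ n : ℕ, max (b n) (b' n) =
      max (b 0) (b' 0) - n * M + ∑ i ∈ Finset.range n, x i := fun n => by
    induction n with
    | zero => simp
    | succ n ih =>
      rw [hstep, ih, Finset.sum_range_succ]
      push_cast
      ring
  -- At time n the walk exceeds M, so its initial value plus the harvests exceeds (n + 1)M; the
  -- extra M goes into the constant that vanishes after division by n.
  have hlim : Tendsto (fun n : ℕ => (max (b 0) (b' 0) - M) / (n : ℝ) +
      (∑ i ∈ Finset.range n, x i) / n) atTop (nhds (0 + l)) :=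
    (tendsto_const_div_atTop_nhds_zero_nat _).add hx
  have hle : M ≤ 0 + l := by
    refine ge_of_tendsto hlim ((eventually_gt_atTop 0).mono fun n hn => ?_)
    have hn' : (0 : ℝ) < n := by exact_mod_cast hn
    have := hgt n
    rw [hsum n] at this
    rw [← add_div, le_div_iff₀ hn']
    linarith
  linarith

/-- The event of disagreement at some time from i on decreases in i to a null set, so continuity
from above applies. -/
lemma tendsto_measureReal_ne {Ω : Type*} [MeasurableSpace Ω] {P : Measure Ω}
    [IsFiniteMeasure P] {f g : ℕ → Ω → ℝ} (hf : ∀ i, Measurable (f i))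
    (hg : ∀ i, Measurable (g i)) (h : ∀ᵐ ω ∂P, ∀ᶠ i in atTop, f i ω = g i ω) :
    Tendsto (fun i => P.real {ω | f i ω ≠ g i ω}) atTop (nhds 0) := by
  set E : ℕ → Set Ω := fun i => ⋃ j ≥ i, {ω | f j ω ≠ g j ω}
  have hE : ∀ i, MeasurableSet (E i) := fun i => MeasurableSet.iUnion fun j =>
    MeasurableSet.iUnion fun _ => (measurableSet_eq_fun (hf j) (hg j)).compl
  have hanti : Antitone E := fun i j hij =>
    iUnion_mono fun l => iUnion_mono' fun hl => ⟨hij.trans hl, subset_rfl⟩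
  have hnull : P (⋂ i, E i) = 0 := by
    refine measure_mono_null (fun ω hω => ?_) h
    simp only [mem_iInter, E, mem_iUnion, mem_ofPred_eq] at hω
    change ¬ ∀ᶠ i in atTop, f i ω = g i ω
    rw [eventually_atTop]
    rintro ⟨i, hi⟩
    obtain ⟨j, hj, hne⟩ := hω i
    exact hne (hi j hj)
  have hlim := tendsto_measure_iInter_atTop (μ := P) (fun i => (hE i).nullMeasurableSet) hanti
    ⟨0, measure_ne_top _ _⟩
  rw [hnull] at hlim
  have hlim' : Tendsto (fun i => P.real (E i)) atTop (nhds 0) := by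
    simpa [Function.comp_def, Measure.real] using
      (ENNReal.tendsto_toReal ENNReal.zero_ne_top).comp hlim
  refine squeeze_zero (fun _ => measureReal_nonneg) (fun i => ?_) hlim'
  exact measureReal_mono (subset_iUnion₂_of_subset i le_rfl subset_rfl) (measure_ne_top _ _)

lemma abs_measureReal_map_sub_le {Ω : Type*} [MeasurableSpace Ω] {P : Measure Ω}
    [IsFiniteMeasure P] {f g : Ω → ℝ} (hf : Measurable f) (hg : Measurable g) {s : Set ℝ}
    (hs : MeasurableSet s) :
    |(P.map f).real s - (P.map g).real s| ≤ P.real {ω | f ω ≠ g ω} := by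
  rw [map_measureReal_apply hf hs, map_measureReal_apply hg hs]
  have key : ∀ a b : Ω → ℝ, P.real (a ⁻¹' s) ≤ P.real (b ⁻¹' s) + P.real {ω | a ω ≠ b ω} := by
    intro a b
    refine (measureReal_mono fun ω hω => ?_).trans (measureReal_union_le _ _)
    by_cases hab : a ω = b ω
    · exact Or.inl (by rwa [mem_preimage, ← hab])
    · exact Or.inr hab
  have h1 := key f g
  have h2 := key g f
  simp_rw [ne_comm (a := g _)] at h2
  exact abs_sub_le_iff.2 ⟨by linarith, by linarith⟩

/-- The chain driven by `X` and started from an independent copy, on the product space. -/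
noncomputable def coupledStorage {Ω : Type*} (M : ℝ) (X : ℕ → Ω → ℝ) : ℕ → Ω × ℝ → ℝ
  | 0 => Prod.snd
  | i + 1 => fun p => max (coupledStorage M X i p - M) 0 + X i p.1

lemma iIndepFun_comp_fst {Ω : Type*} [MeasurableSpace Ω] {P : Measure Ω} {π : Measure ℝ}
    [IsProbabilityMeasure P] [IsProbabilityMeasure π] {X : ℕ → Ω → ℝ}
    (hX : ∀ i, Measurable (X i)) (h : iIndepFun X P) :
    iIndepFun (fun i (p : Ω × ℝ) => X i p.1) (P.prod π) := by
  have hfst : MeasurePreserving Prod.fst (P.prod π) P := measurePreserving_fst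
  rw [iIndepFun_iff_measure_inter_preimage_eq_mul] at h ⊢
  intro S sets hsets
  have h1 : ∀ i ∈ S, (P.prod π) ((fun p : Ω × ℝ => X i p.1) ⁻¹' sets i) =
      P (X i ⁻¹' sets i) := fun i hi =>
    hfst.measure_preimage (hX i (hsets i hi)).nullMeasurableSet
  rw [Finset.prod_congr rfl h1, ← h S hsets, ← hfst.measure_preimage
    (S.measurableSet_biInter fun i hi => hX i (hsets i hi)).nullMeasurableSet]
  congr 1
  ext p
  simp

lemma isBestEffortStorage_coupledStorage {Ω : Type*} [MeasurableSpace Ω] {M : ℝ}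
    {ξ π : Measure ℝ} {P : Measure Ω} [IsProbabilityMeasure P] [IsProbabilityMeasure π]
    {X B : ℕ → Ω → ℝ} (h : IsBestEffortStorage M ξ P X B) (hπ : ∀ᵐ x ∂π, 0 ≤ x) :
    IsBestEffortStorage M ξ (P.prod π) (fun i p => X i p.1) (coupledStorage M X) where
  measurable_harvest i := (h.measurable_harvest i).comp measurable_fst
  measurable_stored i := by
    induction i with
    | zero => exact measurable_snd
    | succ i ih =>
      have := h.measurable_harvest i
      unfold coupledStorage
      fun_prop
  law_harvest i := by
    have := Measure.map_map (μ := P.prod π) (h.measurable_harvest i) measurable_fst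
    rw [measurePreserving_fst.map_eq, h.law_harvest i] at this
    exact this.symm
  indep_harvest := iIndepFun_comp_fst h.measurable_harvest h.indep_harvest
  indep_init :=
    (indepFun_prod (measurable_pi_lambda _ h.measurable_harvest) measurable_id).symm
  init_nonneg := measurePreserving_snd.quasiMeasurePreserving.ae hπ
  storage_eq i := ae_of_all _ fun p => rfl

/-- On P × π the given chain and a stationary one share their harvests and almost surely merge. The
probability that they differ at time i bounds the discrepancy of their laws on every measurable set
at once. -/
theorem isLimitingDistribution_of_invariant {M : ℝ} {ξ π : Measure ℝ} [IsProbabilityMeasure π]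
    (hint : Integrable (fun x => x) ξ) (hmean : ∫ x, x ∂ξ < M) (hπ : ∀ᵐ x ∂π, 0 ≤ x)
    (hinv : (π.prod ξ).map (fun p => max (p.1 - M) 0 + p.2) = π) :
    IsLimitingDistribution.{u} M ξ π := by
  intro Ω _ P _ X B h
  refine ⟨h.map_stored_eq_of_invariant hinv, fun ε hε => ?_⟩
  have hcoup := isBestEffortStorage_coupledStorage h hπ
  have hlaw : ∀ i, (P.prod π).map (coupledStorage M X i) = π :=
    hcoup.map_stored_eq_of_invariant hinv measurePreserving_snd.map_eq
  have hB : ∀ i, Measurable fun p : Ω × ℝ => B i p.1 :=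
    fun i => (h.measurable_stored i).comp measurable_fst
  have hlawB : ∀ i, (P.prod π).map (fun p => B i p.1) = P.map (B i) := fun i => by
    have := Measure.map_map (μ := P.prod π) (h.measurable_stored i) measurable_fst
    rw [measurePreserving_fst.map_eq] at this
    exact this.symm
  have hae : ∀ᵐ p ∂(P.prod π), ∀ᶠ i in atTop, B i p.1 = coupledStorage M X i p := by
    have hst : ∀ᵐ p ∂(P.prod π), ∀ i, B (i + 1) p.1 = max (B i p.1 - M) 0 + X i p.1 :=
      measurePreserving_fst.quasiMeasurePreserving.ae (ae_all_iff.2 h.storage_eq)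
    filter_upwards [hst, hcoup.ae_tendsto_average hint] with p hp hlim
    exact eventually_eq_of_storage hmean hlim hp fun i => rfl
  have hlim := tendsto_measureReal_ne hB hcoup.measurable_stored hae
  filter_upwards [hlim.eventually_le_const hε] with i hi s hs
  have := abs_measureReal_map_sub_le (P := P.prod π) (hB i) (hcoup.measurable_stored i) hs
  rw [hlaw, hlawB] at this
  exact this.trans hi

theorem mainTheorem3 (m : ℕ) (hm : 1 ≤ m) (lam M Xbar δ : ℝ) (hlam : 0 < lam)
    (hXbar : Xbar = ∫ x, x ∂(gammaMeasure (m : ℝ) lam)) (hM : Xbar < M) (hδ : δ = M / Xbar) :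
    IsUnit (coeffMatrix m lam M δ) ∧
    ∀ c : Fin m → ℂ, coeffMatrix m lam M δ *ᵥ c = 1 →
      ∃ π : Measure ℝ, IsProbabilityMeasure π ∧
        IsLimitingDistribution.{u} M (gammaMeasure (m : ℝ) lam) π ∧
        (∀ x : ℝ, 0 ≤ x →
          ((cdf π x : ℝ) : ℂ) = 1 - ∑ n, c n * Complex.exp (-(rate m lam M δ n * (x : ℂ)))) ∧
        ∃ g : ℝ → ℝ,
          (∀ x : ℝ, 0 < x → 0 ≤ g x ∧
            (g x : ℂ) = ∑ n, rate m lam M δ n * c n *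
              Complex.exp (-(rate m lam M δ n * (x : ℂ)))) ∧
          π = (volume.restrict (Ioi 0)).withDensity (fun x => ENNReal.ofReal (g x)) := by
  have hm0 : (0 : ℝ) < m := by exact_mod_cast hm
  have hXeq : Xbar = m / lam := by rw [hXbar, integral_id_gammaMeasure hm0 hlam]
  have hX0 : 0 < Xbar := by rw [hXeq]; positivity
  have hM0 : 0 < M := hX0.trans hM
  have hδ1 : 1 < δ := by rwa [hδ, one_lt_div hX0]
  have hMδ : lam * M = m * δ := by
    rw [hδ, hXeq]
    field_simp
  refine ⟨isUnit_coeffMatrix hlam hδ1 hm hMδ, fun c hc => ?_⟩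
  -- With shape m = k + 1 the gamma density has the natural exponent k.
  obtain ⟨k, rfl⟩ := Nat.exists_eq_add_of_le' hm
  have hprob : IsProbabilityMeasure (expSumLaw lam M δ c) :=
    ⟨expSumLaw_univ hlam hδ1 hMδ hc⟩
  have hnonneg : ∀ᵐ x ∂(expSumLaw lam M δ c), 0 ≤ x :=
    measure_mono_null (fun x (hx : ¬ 0 ≤ x) => (not_le.1 hx).le) expSumLaw_Iic_zero
  refine ⟨expSumLaw lam M δ c, hprob,
    isLimitingDistribution_of_invariant (integrable_id_gammaMeasure hm0 hlam) (hXbar ▸ hM) hnonneg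
      (map_storage_expSumLaw hlam hδ1 hMδ hM0.le hc), fun x hx => ?_,
    expSumDensity lam M δ c, fun x hx => ⟨expSumDensity_nonneg hlam hδ1 hMδ hc hx,
      ofReal_expSumDensity hlam hδ1 hMδ hc hx⟩, rfl⟩
  have hpos : 0 ≤ (expSumCdf lam M δ c x).re := by
    simpa [expSumCdf_zero hc] using monotoneOn_expSumCdf_re hlam hδ1 hMδ hc self_mem_Ici hx hx
  rw [cdf_eq_real, Measure.real, expSumLaw_Iic_of_nonneg hlam hδ1 hMδ hc hx,
    ENNReal.toReal_ofReal hpos, expSumCdf_re_eq hlam hδ1 hMδ hc hx, expSumCdf]
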